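/- Let $d>3$ be an integer. There is a finite constant $c_2>0$, depending only on $d$, such that for every real $A>1$ there is an $N$ (depending on $A$ and $d$) with the following property. Let $n\ge N$, let $\mathbb{G}$ be any $d$-regular simple graph on the vertex set $\{1,\dots,n\}$, let $p\in[0,1]$ with $p\le 1/(d-1)$, and let $\mathbb{G}_p$ be the random graph obtained from $\mathbb{G}$ by bond percolation, i.e. by keeping each edge of $\mathbb{G}$ independently with probability $p$ and deleting it with probability $1-p$. If $|\mathcal{C}_{\max}|$ denotes the number of vertices of a largest connected component of $\mathbb{G}_p$, then $$\mathbb{P}\left(|\mathcal{C}_{\max}|>\lceil An^{2/3}\rceil\right)\le \frac{c_2}{A^{3/2}}.$$ -/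

import Mathlib

namespace BondPercolation

/-- The law of the random graph obtained from `G` by bond percolation with retention probability
`p`: each edge of `G` is kept independently with probability `p` and deleted with probability
`1 - p`; the vertex set is unchanged. -/
noncomputable def bondPercolation {V : Type*} (G : SimpleGraph V) (p : unitInterval) :
    MeasureTheory.Measure (SimpleGraph V) :=
  (ProbabilityTheory.setBernoulli G.edgeSet p).map SimpleGraph.fromEdgeSet

/-- The cluster of the vertex `v`: all vertices joined to `v` by a path (in particular `v`). -/
def cluster {V : Type*} (H : SimpleGraph V) (v : V) : Set V :=
  {u | H.Reachable v u}

/-- The size of a largest cluster, i.e. the maximum over all `v` of the size of the cluster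
of `v`. -/
noncomputable def maxClusterSize {V : Type*} [Fintype V] (H : SimpleGraph V) : ℕ :=
  Finset.univ.sup fun v : V => (cluster H v).ncard

end BondPercolation

namespace BondPercolation

open MeasureTheory ProbabilityTheory

section SetBernoulli

variable {ι : Type*} [Countable ι]

/-! Explore the cluster of a vertex edge by edge; let W count the unexamined edges leaving the
revealed set C. An examination lowers W by 1 or, with probability p, raises it by at most d - 2;
since p(d - 1) ≤ 1, the drift is nonpositive. With a = 1/√k, the potential 4Wa - 2(Wa)² + |C|a² does
not increase in mean until Wa comes close to 1: concavity pays for the growth of C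
(`quadratic_drift_le`). It is at least 1 once |C| ≥ k or 1/2 ≤ Wa ≤ 1, and O(da) at the start, so a
cluster reaches size k with probability at most 5d/√k.

A cluster of size at least k contributes k vertices with large clusters, so Markov's inequality
bounds the tail of the maximum by 5dn/k^(3/2), and k > An^(2/3) finishes. -/

open Classical in
/-- The probability of an event under a product of Bernoulli laws on a finite set, as a sum. -/
lemma setBernoulli_real_eq_sum (E : Finset ι) (p : unitInterval) (P : Set ι → Prop) :
    (setBernoulli (E : Set ι) p).real {s | P s} =
      ∑ s ∈ E.powerset, if P s then (p : ℝ) ^ s.card * (1 - p : ℝ) ^ (E.card - s.card) else 0 := by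
  have hset : {s | s ∈ {s | P s} ∧ s ⊆ (E : Set ι)} =
      (((E.powerset.filter fun s : Finset ι => P s).image ((↑) : Finset ι → Set ι) :
        Finset (Set ι)) : Set (Set ι)) := by
    ext s
    simp only [Set.mem_ofPred_eq, Finset.coe_image, Finset.coe_filter, Finset.mem_powerset,
      Set.mem_image]
    constructor
    · rintro ⟨hs, hsE⟩
      have hfin := E.finite_toSet.subset hsE
      exact ⟨hfin.toFinset, by simpa using ⟨hsE, hs⟩, by simp⟩
    · rintro ⟨t, ⟨htE, ht⟩, rfl⟩
      exact ⟨ht, by exact_mod_cast htE⟩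
  rw [measureReal_def, setBernoulli_apply_eq_apply_subsets, ← measureReal_def, hset,
    ← sum_measureReal_singleton, Finset.sum_image (by simp), Finset.sum_filter]
  refine Finset.sum_congr rfl fun s hs => ?_
  have hs' : (s : Set ι) ⊆ E := by exact_mod_cast Finset.mem_powerset.1 hs
  rw [setBernoulli_real_singleton p hs' E.finite_toSet, Set.ncard_sdiff hs']
  simp

/-- Conditioning on whether a given element is retained. -/
lemma setBernoulli_real_insert [DecidableEq ι] (E : Finset ι) (p : unitInterval)
    (P : Set ι → Prop) {e : ι} (he : e ∉ E) :
    (setBernoulli ((insert e E : Finset ι) : Set ι) p).real {s | P s} =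
      (1 - p) * (setBernoulli (E : Set ι) p).real {s | P s} +
        p * (setBernoulli (E : Set ι) p).real {s | P (insert e s)} := by
  classical
  rw [setBernoulli_real_eq_sum, setBernoulli_real_eq_sum,
    setBernoulli_real_eq_sum E p fun s => P (insert e s),
    Finset.sum_powerset_insert he, Finset.mul_sum, Finset.mul_sum]
  congr 1 <;> refine Finset.sum_congr rfl fun s hs => ?_
  · have hle := Finset.card_le_card (Finset.mem_powerset.1 hs)
    rw [Finset.card_insert_of_notMem he, Nat.succ_sub hle, pow_succ]
    split_ifs <;> ring
  · have hes : e ∉ s := fun h => he (Finset.mem_powerset.1 hs h)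
    rw [Finset.card_insert_of_notMem he, Finset.card_insert_of_notMem hes, Nat.add_sub_add_right,
      Finset.coe_insert]
    split_ifs <;> ring

end SetBernoulli

/-! ### Reachable sets and edge boundaries. -/

section Reach

variable {V : Type*}

/-- The set of vertices joined by a path to a vertex of `C`. -/
def reachSet (H : SimpleGraph V) (C : Set V) : Set V :=
  {u | ∃ v ∈ C, H.Reachable v u}

lemma subset_reachSet (H : SimpleGraph V) (C : Set V) : C ⊆ reachSet H C :=
  fun v hv => ⟨v, hv, .refl v⟩

lemma mem_reachSet_of_adj {H : SimpleGraph V} {C : Set V} {a b : V} (ha : a ∈ reachSet H C)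
    (hab : H.Adj a b) : b ∈ reachSet H C := by
  obtain ⟨v, hv, hva⟩ := ha
  exact ⟨v, hv, hva.trans hab.reachable⟩

lemma reachSet_subset_of_closed {H : SimpleGraph V} {C R : Set V} (hCR : C ⊆ R)
    (hR : ∀ a ∈ R, ∀ b, H.Adj a b → b ∈ R) : reachSet H C ⊆ R := by
  rintro u ⟨v, hv, hvu⟩
  rw [SimpleGraph.reachable_iff_reflTransGen] at hvu
  induction hvu with
  | refl => exact hCR hv
  | tail _ hab ih => exact hR _ ih _ hab

lemma reachSet_singleton (H : SimpleGraph V) (v : V) : reachSet H {v} = cluster H v := by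
  simp [reachSet, cluster]

/-- An open edge absorbs its endpoint, leaving the same problem with one edge fewer; this drives the
induction. -/
lemma reachSet_fromEdgeSet_insert {S : Set (Sym2 V)} {C : Set V} {x w : V} (hx : x ∈ C)
    (hxw : x ≠ w) :
    reachSet (SimpleGraph.fromEdgeSet (insert s(x, w) S)) C =
      reachSet (SimpleGraph.fromEdgeSet S) (insert w C) := by
  apply Set.Subset.antisymm
  · refine reachSet_subset_of_closed ((Set.subset_insert w C).trans (subset_reachSet _ _)) ?_
    intro a ha b hab
    rw [SimpleGraph.fromEdgeSet_adj, Set.mem_insert_iff, Sym2.eq_iff] at hab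
    obtain ⟨(⟨-, rfl⟩ | ⟨-, rfl⟩) | hS, hne⟩ := hab
    · exact subset_reachSet _ _ (Set.mem_insert _ _)
    · exact subset_reachSet _ _ (Set.mem_insert_of_mem _ hx)
    · exact mem_reachSet_of_adj ha ((SimpleGraph.fromEdgeSet_adj _).2 ⟨hS, hne⟩)
  · refine reachSet_subset_of_closed (Set.insert_subset ?_ (subset_reachSet _ _)) ?_
    · exact mem_reachSet_of_adj (subset_reachSet _ _ hx)
        ((SimpleGraph.fromEdgeSet_adj _).2 ⟨Set.mem_insert _ _, hxw⟩)
    · intro a ha b hab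
      rw [SimpleGraph.fromEdgeSet_adj] at hab
      exact mem_reachSet_of_adj ha
        ((SimpleGraph.fromEdgeSet_adj _).2 ⟨Set.mem_insert_of_mem _ hab.1, hab.2⟩)

open Classical in
/-- The edges of `E` joining a vertex of `C` to a vertex outside `C`. -/
noncomputable def boundary (C : Finset V) (E : Finset (Sym2 V)) : Finset (Sym2 V) :=
  E.filter fun e => ∃ x ∈ C, ∃ y ∉ C, e = s(x, y)

lemma mem_boundary {C : Finset V} {E : Finset (Sym2 V)} {e : Sym2 V} :
    e ∈ boundary C E ↔ e ∈ E ∧ ∃ x ∈ C, ∃ y ∉ C, e = s(x, y) := by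
  simp [boundary]

lemma reachSet_of_boundary_eq_empty {C : Finset V} {E : Finset (Sym2 V)}
    (h : boundary C E = ∅) {S : Set (Sym2 V)} (hS : S ⊆ E) :
    reachSet (SimpleGraph.fromEdgeSet S) C = C := by
  refine (reachSet_subset_of_closed subset_rfl ?_).antisymm (subset_reachSet _ _)
  intro a ha b hab
  by_contra hb
  rw [SimpleGraph.fromEdgeSet_adj] at hab
  have : s(a, b) ∈ boundary C E := mem_boundary.2 ⟨hS hab.1, a, ha, b, hb, rfl⟩
  simp [h] at this

lemma boundary_erase [DecidableEq V] (C : Finset V) (E : Finset (Sym2 V)) (e : Sym2 V) :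
    boundary C (E.erase e) = (boundary C E).erase e := by
  ext f
  simp only [mem_boundary, Finset.mem_erase]
  tauto

/-- The examined edge is lost, and `w` brings at most d - 1 others. -/
lemma card_boundary_insert_le [DecidableEq V] [Fintype V] {G : SimpleGraph V}
    [DecidableRel G.Adj] {d : ℕ} (hG : ∀ v, G.degree v ≤ d) {C : Finset V} {E : Finset (Sym2 V)}
    (hE : E ⊆ G.edgeFinset) {x w : V} (he : s(x, w) ∈ boundary C E) :
    (boundary (insert w C) (E.erase s(x, w))).card + 2 ≤ (boundary C E).card + d := by
  have hsub : boundary (insert w C) (E.erase s(x, w)) ⊆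
      (boundary C E).erase s(x, w) ∪ (G.incidenceFinset w).erase s(x, w) := by
    intro f hf
    obtain ⟨hfE, a, ha, b, hb, rfl⟩ := mem_boundary.1 hf
    obtain ⟨hne, hfE'⟩ := Finset.mem_erase.1 hfE
    simp only [Finset.mem_insert, not_or] at ha hb
    rw [Finset.mem_union, Finset.mem_erase, Finset.mem_erase]
    rcases ha with rfl | ha
    · refine .inr ⟨hne, ?_⟩
      rw [SimpleGraph.mem_incidenceFinset, SimpleGraph.mem_incidenceSet]
      simpa using hE hfE'
    · exact .inl ⟨hne, mem_boundary.2 ⟨hfE', a, ha, b, hb.2, rfl⟩⟩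
  have hadj : G.Adj x w := by simpa using hE (mem_boundary.1 he).1
  have hinc : s(x, w) ∈ G.incidenceFinset w := by
    rw [SimpleGraph.mem_incidenceFinset, Sym2.eq_swap, SimpleGraph.mem_incidenceSet]
    exact hadj.symm
  have h1 := (Finset.card_le_card hsub).trans (Finset.card_union_le _ _)
  have h2 := Finset.card_erase_add_one he
  have h3 := Finset.card_erase_add_one hinc
  have h4 := hG w
  rw [SimpleGraph.card_incidenceFinset_eq_degree] at h3
  omega

end Reach

/-! ### The potential and the exploration of one cluster. -/

/-- The quadratic potential is a supermartingale, with a gain of `a ^ 2` for each new vertex,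
for a walk that jumps by `D` with probability `p` and by `-1` otherwise, if the drift is
nonpositive. -/
lemma quadratic_drift_le {a s D p : ℝ} (ha : 0 ≤ a) (hsa : s * a ≤ 1) (hp0 : 0 ≤ p) (hp1 : p ≤ 1)
    (hpD : p * (D + 1) ≤ 1) (hD : 1 ≤ D) :
    (1 - p) * (4 * (s - 1) * a - 2 * (s - 1) ^ 2 * a ^ 2) +
        p * (4 * (s + D) * a - 2 * (s + D) ^ 2 * a ^ 2 + a ^ 2) ≤
      4 * s * a - 2 * s ^ 2 * a ^ 2 := by
  have h1 : 0 ≤ 4 * a * (1 - s * a) * (1 - p * (D + 1)) := by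
    have := sub_nonneg.2 hsa
    have := sub_nonneg.2 hpD
    positivity
  have h2 : 0 ≤ a ^ 2 * (2 * (1 - p) + p * (2 * D ^ 2 - 1)) := by
    have := sub_nonneg.2 hp1
    have : 0 ≤ 2 * D ^ 2 - 1 := by nlinarith
    positivity
  linarith

section Exploration

variable {V : Type*} [Fintype V]

/-- Exploring the cluster edge by edge: `C` is the part revealed so far and `E` the set of edges
that have not been examined. -/
lemma setBernoulli_reachSet_le {G : SimpleGraph V} [DecidableEq V] [DecidableRel G.Adj] {d : ℕ}
    (hd : 3 ≤ d) (hG : ∀ v, G.degree v ≤ d) {p : unitInterval} (hp : (p : ℝ) * (d - 1) ≤ 1)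
    {k : ℕ} {a : ℝ} (ha : 0 < a) (hka : k * a ^ 2 = 1) (hda : 2 * d * a ≤ 1)
    (E : Finset (Sym2 V)) (hE : E ⊆ G.edgeFinset) (C : Finset V)
    (hC : (boundary C E).card * a ≤ 1) :
    (setBernoulli (E : Set (Sym2 V)) p).real
        {S | k ≤ (reachSet (SimpleGraph.fromEdgeSet S) C).ncard} ≤
      4 * (boundary C E).card * a - 2 * (boundary C E).card ^ 2 * a ^ 2 + C.card * a ^ 2 := by
  -- As 4x - 2x² increases for x ≤ 1, overestimating the boundary is harmless.
  have hmono {b W : ℕ} (hbW : b ≤ W) (hW : W * a ≤ 1) :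
      4 * b * a - 2 * b ^ 2 * a ^ 2 ≤ 4 * W * a - 2 * W ^ 2 * a ^ 2 := by
    have h1 : (b : ℝ) * a ≤ W * a := by gcongr
    nlinarith
  induction E using Finset.strongInduction generalizing C with
  | H E ih =>
    rcases (boundary C E).eq_empty_or_nonempty with hB | ⟨e, he⟩
    · by_cases hk : k ≤ C.card
      · refine measureReal_le_one.trans ?_
        rw [hB, ← hka]
        have : (k : ℝ) * a ^ 2 ≤ C.card * a ^ 2 := by gcongr
        simpa using this
      · have hnull : (setBernoulli (E : Set (Sym2 V)) p).real
            {S | k ≤ (reachSet (SimpleGraph.fromEdgeSet S) C).ncard} = 0 := by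
          rw [measureReal_def, setBernoulli_apply_eq_apply_subsets,
            ENNReal.toReal_eq_zero_iff]
          refine .inl (measure_mono_null (t := ∅) (fun S hS => hk ?_) measure_empty)
          have h := hS.1
          rw [Set.mem_ofPred_eq, reachSet_of_boundary_eq_empty hB hS.2,
            Set.ncard_coe_finset] at h
          exact h
        rw [hnull, hB]
        simpa using by positivity
    · set W := (boundary C E).card
      obtain ⟨heE, x, hx, w, hw, rfl⟩ := mem_boundary.1 he
      have hxw : x ≠ w := fun h => hw (h ▸ hx)
      have hd' : (3 : ℝ) ≤ d := by exact_mod_cast hd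
      -- If a jump could push Wa past 1, then `hda` forces Wa ≥ 1/2, where 4x - 2x² ≥ 3/2 exceeds
      -- any probability.
      by_cases hlarge : 1 < (W + d - 2 : ℝ) * a
      · refine measureReal_le_one.trans ?_
        have hhalf : 1 / 2 ≤ W * a := by nlinarith
        have : 0 ≤ (C.card : ℝ) * a ^ 2 := by positivity
        nlinarith
      rw [not_lt] at hlarge
      have hW1 := Finset.card_erase_add_one he
      have hb1 : (boundary C (E.erase s(x, w))).card + 1 = W := by rw [boundary_erase, hW1]
      have hb2 := card_boundary_insert_le hG hE he
      have hcast : ((W + d - 2 : ℕ) : ℝ) = W + d - 2 := by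
        rw [Nat.cast_sub (by omega)]
        push_cast
        ring
      have hss := Finset.erase_ssubset heE
      have hsub := (Finset.erase_subset s(x, w) E).trans hE
      have hb1' : ((boundary C (E.erase s(x, w))).card : ℝ) = W - 1 := by
        rw [← hb1]
        push_cast
        ring
      have hb2' : (boundary (insert w C) (E.erase s(x, w))).card ≤ W + d - 2 := by omega
      have ih1 := ih _ hss hsub C (by rw [hb1']; nlinarith)
      have ih2 := ih _ hss hsub (insert w C) (by
        refine le_trans ?_ (hcast ▸ hlarge)
        gcongr)
      have hm := hmono hb2' (hcast ▸ hlarge)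
      rw [hcast] at hm
      rw [hb1'] at ih1
      rw [Finset.card_insert_of_notMem hw] at ih2
      have hcond := setBernoulli_real_insert (E.erase s(x, w)) p
        (fun S => k ≤ (reachSet (SimpleGraph.fromEdgeSet S) C).ncard)
        (Finset.notMem_erase s(x, w) E)
      rw [Finset.insert_erase heE] at hcond
      simp only [reachSet_fromEdgeSet_insert (Finset.mem_coe.2 hx) hxw, ← Finset.coe_insert]
        at hcond
      rw [hcond]
      rw [Nat.cast_add, Nat.cast_one] at ih2
      have hdrift := quadratic_drift_le (s := W) (D := d - 2) (p := p) ha.le hC p.2.1 p.2.2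
        (by linarith) (by linarith)
      have h1 := mul_le_mul_of_nonneg_left ih1 (sub_nonneg.2 p.2.2)
      have h2 := mul_le_mul_of_nonneg_left (ih2.trans (add_le_add_left hm _)) p.2.1
      refine (add_le_add h1 h2).trans ?_
      linear_combination hdrift

/-- The tail of the cluster size of a given vertex, for large thresholds. -/
lemma setBernoulli_cluster_le {G : SimpleGraph V} [DecidableRel G.Adj] {d : ℕ}
    (hd : 3 ≤ d) (hG : ∀ v, G.degree v ≤ d) {p : unitInterval} (hp : (p : ℝ) * (d - 1) ≤ 1)
    {k : ℕ} (hk : 0 < k) (v : V) :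
    (setBernoulli G.edgeSet p).real
        {S | k ≤ (cluster (SimpleGraph.fromEdgeSet S) v).ncard} ≤ 5 * d / √k := by
  classical
  have hk' : (0 : ℝ) < √k := Real.sqrt_pos.2 (by exact_mod_cast hk)
  have hd' : (3 : ℝ) ≤ d := by exact_mod_cast hd
  -- Otherwise the claimed bound exceeds 1.
  by_cases hlarge : 2 * (d : ℝ) ≤ √k
  · have hB : (boundary {v} G.edgeFinset).card ≤ d := by
      refine le_trans ?_ (hG v)
      rw [← SimpleGraph.card_incidenceFinset_eq_degree]
      refine Finset.card_le_card fun e he => ?_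
      obtain ⟨heE, x, hx, y, -, rfl⟩ := mem_boundary.1 he
      obtain rfl := Finset.mem_singleton.1 hx
      rw [SimpleGraph.mem_incidenceFinset, SimpleGraph.mem_incidenceSet]
      simpa using heE
    have ha : 0 < 1 / √k := by positivity
    have hda : 2 * (d : ℝ) * (1 / √k) ≤ 1 := by
      rwa [mul_one_div, div_le_one hk']
    have hBa : ((boundary {v} G.edgeFinset).card : ℝ) * (1 / √k) ≤ d * (1 / √k) := by gcongr
    have hka : (k : ℝ) * (1 / √k) ^ 2 = 1 := by
      rw [div_pow, Real.sq_sqrt (by positivity)]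
      field_simp
    -- With a ≤ 1, the initial potential is at most 4da + a² ≤ 5da.
    have ha1 : 1 / √k ≤ 1 := by nlinarith
    have h := setBernoulli_reachSet_le hd hG hp ha hka hda G.edgeFinset subset_rfl {v}
      (by linarith)
    simp only [SimpleGraph.coe_edgeFinset, Finset.coe_singleton, reachSet_singleton,
      Finset.card_singleton, Nat.cast_one, one_mul] at h
    refine h.trans ?_
    rw [← mul_one_div (5 * (d : ℝ))]
    nlinarith [sq_nonneg (((boundary {v} G.edgeFinset).card : ℝ) * (1 / √k))]
  · refine measureReal_le_one.trans ?_
    rw [le_div_iff₀ hk']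
    linarith

end Exploration

/-! ### From one cluster to the largest. -/

lemma le_card_of_le_maxClusterSize {V : Type*} [Fintype V] {H : SimpleGraph V} {k : ℕ}
    (hk : 0 < k) (h : k ≤ maxClusterSize H) :
    k ≤ {v | k ≤ (cluster H v).ncard}.ncard := by
  obtain ⟨v, -, hv⟩ := (Finset.le_sup_iff (bot_lt_iff_ne_bot.2 hk.ne')).1 h
  refine hv.trans (Set.ncard_le_ncard fun u hu => ?_)
  have huv : cluster H u = cluster H v :=
    Set.ext fun z => ⟨fun hz => hu.trans hz, fun hz => hu.symm.trans hz⟩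
  simpa [huv] using hv

/-- The tail of the size of a largest cluster in bounded degree, by Markov's inequality for the
number of vertices in large clusters. -/
lemma bondPercolation_maxClusterSize_le {V : Type*} [Fintype V] {G : SimpleGraph V}
    [DecidableRel G.Adj] {d : ℕ} (hd : 3 ≤ d) (hG : ∀ v, G.degree v ≤ d) {p : unitInterval}
    (hp : (p : ℝ) * (d - 1) ≤ 1) {k : ℕ} (hk : 0 < k) :
    (bondPercolation G p).real {H | k ≤ maxClusterSize H} ≤
      5 * d * Fintype.card V / (k * √k) := by
  classical
  have hk' : (0 : ℝ) < k := by exact_mod_cast hk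
  have hmeas (P : SimpleGraph V → Prop) : MeasurableSet {H | P H} :=
    SimpleGraph.measurableEmbedding_edgeSet.measurableSet_image.1 (Set.toFinite _).measurableSet
  rw [bondPercolation, map_measureReal_apply SimpleGraph.measurable_fromEdgeSet (hmeas _)]
  have hmarkov := mul_meas_ge_le_integral_of_nonneg
    (μ := setBernoulli G.edgeSet p)
    (f := fun S => ∑ v : V, Set.indicator
      {S | k ≤ (cluster (SimpleGraph.fromEdgeSet S) v).ncard} (fun _ => (1 : ℝ)) S)
    (Filter.Eventually.of_forall fun S => Finset.sum_nonneg fun v _ =>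
      Set.indicator_nonneg (fun _ _ => zero_le_one) _) .of_finite k
  rw [integral_finsetSum _ fun _ _ => .of_finite] at hmarkov
  simp only [integral_indicator_const (1 : ℝ) (Set.Finite.measurableSet (Set.toFinite _)),
    smul_eq_mul, mul_one] at hmarkov
  have hsum := Finset.sum_le_sum fun (v : V) (_ : v ∈ Finset.univ) =>
    setBernoulli_cluster_le hd hG hp hk v
  rw [Finset.sum_const, Finset.card_univ, nsmul_eq_mul] at hsum
  have hsub : SimpleGraph.fromEdgeSet ⁻¹' {H : SimpleGraph V | k ≤ maxClusterSize H} ⊆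
      {S | (k : ℝ) ≤ ∑ v : V, Set.indicator
        {S | k ≤ (cluster (SimpleGraph.fromEdgeSet S) v).ncard} (fun _ => (1 : ℝ)) S} := by
    intro S hS
    have h := le_card_of_le_maxClusterSize hk hS
    rw [Set.ncard_eq_toFinset_card'] at h
    simp only [Set.mem_ofPred_eq, Set.indicator_apply, Finset.sum_boole]
    simpa using h
  have h := mul_le_mul_of_nonneg_left
    (measureReal_mono (μ := setBernoulli G.edgeSet p) hsub) hk'.le
  rw [mul_comm (k : ℝ) √k, ← div_div, le_div_iff₀ hk', mul_comm]
  refine (h.trans (hmarkov.trans hsum)).trans (le_of_eq (by ring))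

end BondPercolation

theorem proposition2 (d : ℕ) (hd : 3 < d) :
    ∃ c₂ : ℝ, 0 < c₂ ∧
      ∀ A : ℝ, 1 < A →
        ∃ N : ℕ, ∀ n : ℕ, N ≤ n →
          ∀ (G : SimpleGraph (Fin n)) [DecidableRel G.Adj], G.IsRegularOfDegree d →
            ∀ p : unitInterval, (p : ℝ) ≤ 1 / ((d : ℝ) - 1) →
              (BondPercolation.bondPercolation G p).real
                  {H | ⌈A * (n : ℝ) ^ (2 / 3 : ℝ)⌉₊ < BondPercolation.maxClusterSize H}
                ≤ c₂ / A ^ (3 / 2 : ℝ) := by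
  refine ⟨5 * d, by positivity, fun A hA => ⟨1, fun n hn G _ hG p hp => ?_⟩⟩
  have hA0 : 0 < A := by linarith
  have hn0 : (0 : ℝ) < n := by exact_mod_cast hn
  have hd1 : (0 : ℝ) < d - 1 := by
    have : (3 : ℝ) < d := by exact_mod_cast hd
    linarith
  set x := A * (n : ℝ) ^ (2 / 3 : ℝ) with hx
  have hx0 : 0 < x := by positivity
  have hxk : x ≤ ((⌈x⌉₊ + 1 : ℕ) : ℝ) := by
    push_cast
    linarith [Nat.le_ceil x]
  -- On naturals, `⌈x⌉₊ < m` unfolds to `⌈x⌉₊ + 1 ≤ m`, so k = `⌈x⌉₊ + 1`.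
  have h := BondPercolation.bondPercolation_maxClusterSize_le hd.le (fun v => (hG v).le)
    ((le_div_iff₀ hd1).1 hp) (Nat.succ_pos ⌈x⌉₊)
  have hpow : x * √x = A ^ (3 / 2 : ℝ) * n := by
    have h32 : x * √x = x ^ (3 / 2 : ℝ) := by
      rw [Real.sqrt_eq_rpow, ← Real.rpow_one_add' hx0.le (by norm_num)]
      norm_num
    rw [h32, hx, Real.mul_rpow hA0.le (by positivity), ← Real.rpow_mul hn0.le]
    norm_num
  refine h.trans ?_
  rw [Fintype.card_fin]
  calc 5 * (d : ℝ) * n / (((⌈x⌉₊ + 1 : ℕ) : ℝ) * √((⌈x⌉₊ + 1 : ℕ) : ℝ))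
      ≤ 5 * (d : ℝ) * n / (x * √x) := by gcongr
    _ = 5 * d / A ^ (3 / 2 : ℝ) := by
      rw [hpow]
      field_simp
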